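/- Let $\mathcal A$ be a complex unital $*$-algebra, $(\mathcal H,[\cdot,\cdot])$ a Kre\u{\i}n space, i.e. a complex indefinite inner product space for which there are a Hilbert space inner product $\langle\cdot,\cdot\rangle$ on $\mathcal H$ and a symmetry $J=J^*=J^{-1}$ with $[\xi,\eta]=\langle J\xi,\eta\rangle$, and let $T:\mathcal A\to\mathcal L(\mathcal H)$ be a linear map that is hermitian: $T(a^*)=T(a)^\sharp$ for all $a\in\mathcal A$. Here $\mathcal L(\mathcal H)$ denotes the bounded operators and ${}^\sharp$ the adjoint with respect to $[\cdot,\cdot]$. For a kernel $K:\mathcal A\times\mathcal A\to\mathcal L(\mathcal H)$ and finitely supported functions $f,g:\mathcal A\to\mathcal H$ put $[f,g]_K=\sum_{x,y\in\mathcal A}[K(x,y)f(y),g(x)]$. The kernel $K$ is hermitian if $K(x,y)=K(y,x)^\sharp$ for all $x,y$, and positive definite if in addition $[f,f]_K\ge 0$ for all $f$; for hermitian kernels, $K\le K'$ means $[f,f]_K\le[f,f]_{K'}$ for all $f$. For $a\in\mathcal A$ let $\psi_a$ be the linear map on finitely supported functions that sends $\xi_x$ (the function with value $\xi$ at $x$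 and $0$ elsewhere) to $\xi_{xa^*}$. A positive definite kernel $L$ is $\phi$-bounded, for the action $\phi(a,x)=xa^*$, if for each $a\in\mathcal A$ the map $\psi_a$ is bounded with respect to the seminorm $[f,f]_L^{1/2}$. Finally let $K_T(x,y)=T(xy^*)$. Then the following assertions are equivalent: (1) There is a $\phi$-bounded positive definite kernel $L:\mathcal A\times\mathcal A\to\mathcal L(\mathcal H)$ such that $-L\le K_T\le L$. (2) $T$ has a minimal Stinespring dilation: there are a Kre\u{\i}n space $\mathcal K$, a linear and multiplicative map $\pi:\mathcal A\to\mathcal L(\mathcal K)$ with $\pi(a^*)=\pi(a)^\sharp$ for all $a\in\mathcal A$, and a bounded operator $B\in\mathcal L(\mathcal H,\mathcal K)$ such that $T(a)=B^\sharp\pi(a)B$ for all $a\in\mathcal A$ and the linear span of $\bigcup_{a\in\mathcal A}\pi(a)B\mathcal H$ is dense in $\mathcal K$. -/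

import Mathlib

universe u v w

noncomputable section

/-- A Kreĭn space: a complex vector space with an indefinite inner product `[·,·]` for which there
are a Hilbert space inner product `⟨·,·⟩` and a symmetry `J` (`J* = J⁻¹ = J`) with
`[ξ, η] = ⟨J ξ, η⟩`. It is presented by such a Hilbert space (whose norm is a unitary norm, and whose
topology is the strong topology, independent of the choice of `J`) and such a `J`; every Kreĭn space
arises in this way. -/
class KreinSpace (H : Type*) [NormedAddCommGroup H] [InnerProductSpace ℂ H] [CompleteSpace H] where
  /-- The fundamental symmetry. -/
  J : H →L[ℂ] H
  adjoint_J : ContinuousLinearMap.adjoint J = J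
  J_comp_J : J ∘L J = ContinuousLinearMap.id ℂ H

namespace KreinSpace

section Basic

variable {H : Type*} [NormedAddCommGroup H] [InnerProductSpace ℂ H] [CompleteSpace H] [KreinSpace H]
variable {K : Type*} [NormedAddCommGroup K] [InnerProductSpace ℂ K] [CompleteSpace K] [KreinSpace K]

/-- The indefinite inner product `[ξ, η] = ⟨J ξ, η⟩`, linear in `ξ` and antilinear in `η`
(Mathlib's `inner` is linear in its second argument). -/
def form (ξ η : H) : ℂ := inner ℂ η (J ξ)

/-- The adjoint `T♯` of a bounded operator `T` with respect to the indefinite inner products. -/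
def sharp (T : H →L[ℂ] K) : K →L[ℂ] H := J ∘L ContinuousLinearMap.adjoint T ∘L J

theorem J_J (ξ : H) : J (J ξ) = ξ := by
  simpa using congrArg (fun S : H →L[ℂ] H => S ξ) (J_comp_J (H := H))

theorem form_eq_inner_J_left (ξ η : H) : form ξ η = inner ℂ (J η) ξ := by
  have h := ContinuousLinearMap.adjoint_inner_left (J : H →L[ℂ] H) ξ η
  rw [adjoint_J] at h
  exact h.symm

/-- The defining property of `T♯`. -/
theorem form_sharp (T : H →L[ℂ] K) (ξ : H) (η : K) : form (T ξ) η = form ξ (sharp T η) := by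
  rw [form_eq_inner_J_left, form_eq_inner_J_left]
  simp [sharp, J_J, ContinuousLinearMap.adjoint_inner_left]

/-- `T♯` is the only operator with that property. -/
theorem eq_sharp (T : H →L[ℂ] K) (S : K →L[ℂ] H) (h : ∀ ξ η, form (T ξ) η = form ξ (S η)) :
    S = sharp T := by
  ext η
  have h1 : ∀ ξ : H, inner ℂ (J (S η)) ξ = inner ℂ (J (sharp T η)) ξ := fun ξ => by
    rw [← form_eq_inner_J_left, ← form_eq_inner_J_left, ← h, form_sharp]
  have h2 := congrArg J (ext_inner_right ℂ h1)
  rwa [J_J, J_J] at h2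

end Basic

section Kernels

variable {X : Type*}
variable {H : Type*} [NormedAddCommGroup H] [InnerProductSpace ℂ H] [CompleteSpace H] [KreinSpace H]

/-- An `ℒ(H)`-valued kernel on `X` is hermitian if `K(x, y) = K(y, x)♯`. -/
def IsHermitianKernel (K : X → X → H →L[ℂ] H) : Prop :=
  ∀ x y, K x y = sharp (K y x)

/-- The inner product `[f, g]_K = ∑_{x, y} [K(x, y) f(y), g(x)]` on the space `X →₀ H` of finitely
supported `H`-valued functions on `X`. -/
def kernelForm (K : X → X → H →L[ℂ] H) (f g : X →₀ H) : ℂ :=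
  ∑ x ∈ g.support, ∑ y ∈ f.support, form (K x y (f y)) (g x)

open scoped ComplexOrder in
/-- A positive definite kernel: a hermitian kernel `L` with `[f, f]_L ≥ 0` for all `f`. -/
def IsPosDefKernel (L : X → X → H →L[ℂ] H) : Prop :=
  IsHermitianKernel L ∧ ∀ f : X →₀ H, 0 ≤ kernelForm L f f

open scoped ComplexOrder in
/-- The order on hermitian kernels: `A ≤ B` if `[f, f]_A ≤ [f, f]_B` for all `f`. -/
def KernelLE (A B : X → X → H →L[ℂ] H) : Prop :=
  ∀ f : X →₀ H, kernelForm A f f ≤ kernelForm B f f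

/-- The seminorm `[f, f]_L^{1/2}` of a positive definite kernel `L`. -/
def kernelSeminorm (L : X → X → H →L[ℂ] H) (f : X →₀ H) : ℝ :=
  √(kernelForm L f f).re

/-- For `φ : S → X → X` and `a : S`, the linear map `ψ_a` on finitely supported functions that sends
`ξ_x` (the function with value `ξ` at `x` and `0` elsewhere) to `ξ_{φ(a, x)}`. -/
def psi {S : Type*} (φ : S → X → X) (a : S) : (X →₀ H) →ₗ[ℂ] (X →₀ H) :=
  Finsupp.lmapDomain H ℂ (φ a)

/-- The set `ℬ_φ⁺(X, H)` of `φ`-bounded positive definite kernels: each `ψ_a` is bounded with respect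
to the seminorm induced by the kernel. -/
def boundedPosDefKernels {S : Type*} (φ : S → X → X) : Set (X → X → H →L[ℂ] H) :=
  {L | IsPosDefKernel L ∧
    ∀ a : S, ∃ C : ℝ, ∀ f : X →₀ H, kernelSeminorm L (psi φ a f) ≤ C * kernelSeminorm L f}

end Kernels

section Dilation

variable {A : Type u} [Ring A] [StarRing A] [Algebra ℂ A]
variable {H : Type v} [NormedAddCommGroup H] [InnerProductSpace ℂ H] [CompleteSpace H] [KreinSpace H]

/-- The action of a `*`-algebra on itself by `φ(a, x) = x a*`. -/
def starAction (a x : A) : A := x * star a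

/-- A linear map `T : A → ℒ(H)` is hermitian if `T(a*) = T(a)♯`. -/
def IsHermitianMap (T : A →ₗ[ℂ] (H →L[ℂ] H)) : Prop :=
  ∀ a, T (star a) = sharp (T a)

/-- The kernel `K_T(x, y) = T(x y*)`. -/
def mapKernel (T : A →ₗ[ℂ] (H →L[ℂ] H)) (x y : A) : H →L[ℂ] H :=
  T (x * star y)

variable {K : Type*} [NormedAddCommGroup K] [InnerProductSpace ℂ K] [CompleteSpace K] [KreinSpace K]

/-- A (linear, multiplicative) representation `π : A → ℒ(K)` is selfadjoint if `π(a*) = π(a)♯`. -/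
def IsSelfadjointRep (π : A →ₙₐ[ℂ] (K →L[ℂ] K)) : Prop :=
  ∀ a, π (star a) = sharp (π a)

/-- The triple `(π, K, B)` is a Stinespring dilation of `T`. -/
structure IsStinespringDilation (T : A →ₗ[ℂ] (H →L[ℂ] H)) (π : A →ₙₐ[ℂ] (K →L[ℂ] K))
    (B : H →L[ℂ] K) : Prop where
  selfadjoint : IsSelfadjointRep π
  dilation : ∀ a, T a = sharp B ∘L π a ∘L B

/-- The triple `(π, K, B)` is a minimal Stinespring dilation of `T`: moreover the linear span of the
sets `π(a) B H` is dense in `K` (which forces `π(1) = I`). -/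
structure IsMinimalStinespringDilation (T : A →ₗ[ℂ] (H →L[ℂ] H)) (π : A →ₙₐ[ℂ] (K →L[ℂ] K))
    (B : H →L[ℂ] K) : Prop extends IsStinespringDilation T π B where
  minimal : Dense (Submodule.span ℂ {k : K | ∃ (a : A) (ξ : H), k = π a (B ξ)} : Set K)

/-- `T` has a minimal Stinespring dilation (on a Kreĭn space in the universe `w`). -/
def HasMinimalStinespringDilation (T : A →ₗ[ℂ] (H →L[ℂ] H)) : Prop :=
  ∃ (K : Type w) (_ : NormedAddCommGroup K) (_ : InnerProductSpace ℂ K) (_ : CompleteSpace K)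
    (_ : KreinSpace K) (π : A →ₙₐ[ℂ] (K →L[ℂ] K)) (B : H →L[ℂ] K),
    IsMinimalStinespringDilation T π B

/-- In a minimal Stinespring dilation the representation is unital. -/
theorem IsMinimalStinespringDilation.map_one {T : A →ₗ[ℂ] (H →L[ℂ] H)}
    {π : A →ₙₐ[ℂ] (K →L[ℂ] K)} {B : H →L[ℂ] K} (h : IsMinimalStinespringDilation T π B) :
    π 1 = 1 := by
  refine ContinuousLinearMap.ext_on h.minimal ?_
  rintro _ ⟨a, ξ, rfl⟩
  have h1 : π 1 * π a = π a := by rw [← _root_.map_mul, one_mul]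
  exact congrArg (fun S : K →L[ℂ] K => S (B ξ)) h1

end Dilation

end KreinSpace

end

/-! Given a dilation, `K_T(x, y) = B♯ π(x) π(y*) B`. Inserting the symmetry of the dilation space
between `π(x)` and `π(y*)` turns the indefinite form into a Hilbert inner product and gives `L`.
Since `|[k, k]| ≤ ‖k‖²`, this `L` dominates `K_T`, and `ψ_a` is bounded because it is intertwined
with `π(a)`.

Conversely, complete the finitely supported functions for `L` to a Hilbert space. The domination
makes `K_T` a bounded form there, with selfadjoint Gram operator `G` (`exists_gram_operator`).
Completing again for `⟨|G| ·, ·⟩` and using the sign of `G` as symmetry yields a Kreĭn space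
(`exists_kreinSpace_of_isSelfAdjoint`). The delicate point is that `ψ_a`, bounded for `L`, stays
bounded for `|G|`. It has the `K_T`-adjoint `ψ_{a*}`, also bounded for `L`, so the Krein–Reid–Lax
argument (`norm_map_le_of_adjoint`) applies. The extended operators form `π`, and `B` sends `ξ` to
the class of `ξ_1`. -/

noncomputable section

namespace KreinSpace

/-! ### Hilbert space tools: completion, Krein–Reid–Lax bounds, the sign of a selfadjoint operator.
-/

section Hilbert

/-- The Hilbert space obtained from a space with a positive semidefinite form by separation and
completion. -/
theorem exists_hilbert_completion {V : Type u} [AddCommGroup V] [Module ℂ V]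
    (c : PreInnerProductSpace.Core ℂ V) :
    ∃ (E : Type max u w) (_ : NormedAddCommGroup E) (_ : InnerProductSpace ℂ E)
      (_ : CompleteSpace E) (ι : V →ₗ[ℂ] E),
      DenseRange ι ∧ ∀ f g, inner ℂ (ι f) (ι g) = c.inner f g := by
  -- The lift only adjusts the universe of the completion.
  let c' : PreInnerProductSpace.Core ℂ (ULift.{w} V) :=
    { inner := fun x y => c.inner x.down y.down
      conj_inner_symm := fun x y => c.conj_inner_symm _ _
      re_inner_nonneg := fun x => c.re_inner_nonneg _
      add_left := fun x y z => c.add_left _ _ _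
      smul_left := fun x y r => c.smul_left _ _ _ }
  let _ : SeminormedAddCommGroup (ULift.{w} V) :=
    InnerProductSpace.Core.toSeminormedAddCommGroup (c := c')
  let _ : InnerProductSpace ℂ (ULift.{w} V) := InnerProductSpace.ofCore c'
  refine ⟨UniformSpace.Completion (ULift.{w} V), inferInstance, inferInstance, inferInstance,
    (UniformSpace.Completion.toComplₗᵢ (𝕜 := ℂ) (E := ULift.{w} V)).toLinearMap ∘ₗ
      (ULift.moduleEquiv (R := ℂ) (M := V)).symm.toLinearMap, ?_, fun f g => ?_⟩
  · exact (UniformSpace.Completion.denseRange_coe (α := ULift.{w} V)).comp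
      (ULift.moduleEquiv (R := ℂ) (M := V)).symm.surjective.denseRange
      (UniformSpace.Completion.continuous_coe _)
  · exact UniformSpace.Completion.inner_coe (𝕜 := ℂ) (ULift.up f) (ULift.up g)

theorem norm_eq_sqrt_core_inner {V : Type*} [AddCommGroup V] [Module ℂ V]
    {E : Type*} [NormedAddCommGroup E] [InnerProductSpace ℂ E] {c : PreInnerProductSpace.Core ℂ V}
    {ι : V →ₗ[ℂ] E} (hι : ∀ f g, inner ℂ (ι f) (ι g) = c.inner f g) (f : V) :
    ‖ι f‖ = √(c.inner f f).re := by
  rw [← hι, norm_eq_sqrt_re_inner (𝕜 := ℂ)]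
  rfl

/-- A geometric comparison: a logarithmically convex sequence of geometric growth at most `c ^ n`
satisfies `b 1 ≤ c * b 0`. -/
theorem le_mul_of_sq_le_mul_of_le_geometric {b : ℕ → ℝ} {c M : ℝ} (hb : ∀ n, 0 ≤ b n)
    (hc : 0 ≤ c) (hlog : ∀ n, b (n + 1) ^ 2 ≤ b n * b (n + 2)) (hM : ∀ n, b n ≤ M * c ^ n) :
    b 1 ≤ c * b 0 := by
  by_contra! h
  have hb1 : 0 < b 1 := (mul_nonneg hc (hb 0)).trans_lt h
  have hb0 : 0 < b 0 := by
    refine (hb 0).lt_of_ne fun h0 => ?_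
    have := hlog 0
    rw [← h0, zero_mul] at this
    nlinarith
  -- By log-convexity the ratios `b (n + 1) / b n` never fall below the first one, `r`. So `b` grows
  -- at least like `r ^ n`, which `M * c ^ n` cannot match if `c < r`.
  set r := b 1 / b 0 with hr
  have hrpos : 0 < r := div_pos hb1 hb0
  have hcr : c < r := (lt_div_iff₀ hb0).2 h
  have hstep : ∀ n, 0 < b n ∧ r * b n ≤ b (n + 1) := by
    intro n
    induction n with
    | zero => exact ⟨hb0, by rw [hr, div_mul_cancel₀ _ hb0.ne']⟩
    | succ n ih =>
      have h1 : 0 < b (n + 1) := (mul_pos hrpos ih.1).trans_le ih.2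
      refine ⟨h1, ?_⟩
      have h2 := hlog n
      have h3 : r * b n * b (n + 1) ≤ b n * b (n + 2) := by
        refine le_trans ?_ h2
        rw [sq]
        exact mul_le_mul_of_nonneg_right ih.2 h1.le
      refine le_of_mul_le_mul_left ?_ ih.1
      linarith
  have hgeo : ∀ n, r ^ n * b 0 ≤ b n := by
    intro n
    induction n with
    | zero => simp
    | succ n ih =>
      calc r ^ (n + 1) * b 0 = r * (r ^ n * b 0) := by ring
        _ ≤ r * b n := mul_le_mul_of_nonneg_left ih hrpos.le
        _ ≤ b (n + 1) := (hstep n).2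
  have hle : ∀ n, b 0 ≤ M * (c / r) ^ n := by
    intro n
    have h1 := (hgeo n).trans (hM n)
    rw [div_pow, ← mul_div_assoc, le_div_iff₀ (pow_pos hrpos n)]
    linarith
  have hlim : Filter.Tendsto (fun n : ℕ => M * (c / r) ^ n) Filter.atTop (nhds (M * 0)) :=
    (tendsto_pow_atTop_nhds_zero_of_lt_one (div_nonneg hc hrpos.le)
      ((div_lt_one hrpos).2 hcr)).const_mul M
  have := ge_of_tendsto' hlim hle
  linarith

variable {E : Type*} [NormedAddCommGroup E] [InnerProductSpace ℂ E]
variable {F : Type*} [NormedAddCommGroup F] [InnerProductSpace ℂ F]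

/-- An operator that is symmetric for the semi-inner product induced by `P` is bounded for it by its
operator norm (Krein, Reid, Lax). -/
theorem norm_map_le_of_symmetric (P : E →L[ℂ] F) (A : E →L[ℂ] E)
    (h : ∀ x y, inner ℂ (P (A x)) (P y) = inner ℂ (P x) (P (A y))) (x : E) :
    ‖P (A x)‖ ≤ ‖A‖ * ‖P x‖ := by
  -- Symmetry moves one factor `A` across the form, and Cauchy–Schwarz then makes `‖P (A ^ n x)‖`
  -- log-convex in `n`.
  have key := le_mul_of_sq_le_mul_of_le_geometric (b := fun n => ‖P ((A ^ n) x)‖) (c := ‖A‖)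
    (M := ‖P‖ * ‖x‖) (fun n => norm_nonneg _) (norm_nonneg _) (fun n => ?_) (fun n => ?_)
  · simpa using key
  · have h1 : ‖P ((A ^ (n + 1)) x)‖ ^ 2 = ‖inner ℂ (P ((A ^ n) x)) (P ((A ^ (n + 2)) x))‖ := by
      rw [pow_succ' A (n + 1), mul_apply_eq_comp, ← h, ← mul_apply_eq_comp,
        ← pow_succ', inner_self_eq_norm_sq_to_K]
      simp
    simp only [h1]
    exact norm_inner_le_norm _ _
  · calc ‖P ((A ^ n) x)‖ ≤ ‖P‖ * (‖A ^ n‖ * ‖x‖) :=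
          P.le_of_opNorm_le_of_le le_rfl ((A ^ n).le_opNorm x)
      _ ≤ ‖P‖ * (‖A‖ ^ n * ‖x‖) := by
          gcongr
          rcases Nat.eq_zero_or_pos n with rfl | hn
          · simpa using! ContinuousLinearMap.norm_id_le (𝕜 := ℂ) (E := E)
          · exact norm_pow_le' A hn
      _ = ‖P‖ * ‖x‖ * ‖A‖ ^ n := by ring

/-- An operator with an adjoint for the semi-inner product induced by `P` is bounded for it. -/
theorem norm_map_le_of_adjoint (P : E →L[ℂ] F) (S R : E →L[ℂ] E)
    (h : ∀ x y, inner ℂ (P (S x)) (P y) = inner ℂ (P x) (P (R y))) :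
    ∃ C, ∀ x, ‖P (S x)‖ ≤ C * ‖P x‖ := by
  have h' : ∀ x y, inner ℂ (P (R x)) (P y) = inner ℂ (P x) (P (S y)) := fun x y => by
    rw [← inner_conj_symm, ← h, inner_conj_symm]
  -- `R ∘L S` is symmetric for the semi-inner product, and `‖P (S x)‖² = ⟨P x, P (R S x)⟩`; hence
  -- the square root.
  refine ⟨√‖R ∘L S‖, fun x => ?_⟩
  have h1 := norm_map_le_of_symmetric P (R ∘L S) (fun x y => by simp [h, h']) x
  have h2 : ‖P (S x)‖ ^ 2 ≤ ‖R ∘L S‖ * ‖P x‖ ^ 2 := by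
    have h3 : ‖P (S x)‖ ^ 2 = ‖inner ℂ (P x) (P ((R ∘L S) x))‖ := by
      rw [ContinuousLinearMap.comp_apply, ← h, inner_self_eq_norm_sq_to_K]
      simp
    rw [h3]
    refine (norm_inner_le_norm _ _).trans ?_
    nlinarith [norm_nonneg (P x)]
  calc ‖P (S x)‖ = √(‖P (S x)‖ ^ 2) := (Real.sqrt_sq (norm_nonneg _)).symm
    _ ≤ √(‖R ∘L S‖ * ‖P x‖ ^ 2) := Real.sqrt_le_sqrt h2
    _ = √‖R ∘L S‖ * ‖P x‖ := by
      rw [Real.sqrt_mul (norm_nonneg _), Real.sqrt_sq (norm_nonneg _)]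

/-- A bounded operator intertwined by a map with dense range. -/
theorem exists_extension {V : Type*} [AddCommGroup V] [Module ℂ V]
    [CompleteSpace F] {e : V →ₗ[ℂ] E} (he : DenseRange e)
    (f : V →ₗ[ℂ] F) (h : ∃ C, ∀ x, ‖f x‖ ≤ C * ‖e x‖) : ∃ S : E →L[ℂ] F, ∀ x, S (e x) = f x :=
  ⟨f.extendOfNorm e, LinearMap.extendOfNorm_eq he h⟩

variable [CompleteSpace E]

/-- Two positive operators with product zero have ranges separated by a symmetry. -/
theorem exists_symmetry_mul_eq {P N : E →L[ℂ] E} (hP : P.IsPositive) (h : P * N = 0) :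
    ∃ R : E →L[ℂ] E, IsSelfAdjoint R ∧ R * R = 1 ∧ R * P = P ∧ R * N = -N := by
  -- The symmetry is the reflection in `M`. Since `P` is symmetric and `P * N = 0`, the range of `N`
  -- lies in the orthogonal complement of `M`.
  let M : Submodule ℂ E := (LinearMap.range P.toLinearMap).topologicalClosure
  have : CompleteSpace M := (Submodule.isClosed_topologicalClosure _).completeSpace_coe
  obtain ⟨R, hR⟩ : ∃ R : E →L[ℂ] E, ∀ x, R x = M.reflection x :=
    ⟨M.reflection.toContinuousLinearEquiv.toContinuousLinearMap, fun _ => rfl⟩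
  refine ⟨R, ?_, ?_, ?_, ?_⟩
  · rw [ContinuousLinearMap.isSelfAdjoint_iff_isSymmetric]
    intro x y
    have h1 := M.reflection.inner_map_map x (M.reflection y)
    rw [Submodule.reflection_reflection, ← hR, ← hR] at h1
    exact h1
  · ext x
    rw [mul_apply_eq_comp, hR, hR]
    exact Submodule.reflection_reflection M x
  · ext x
    rw [mul_apply_eq_comp, hR]
    exact Submodule.reflection_mem_subspace_eq_self
      (Submodule.le_topologicalClosure _ (LinearMap.mem_range_self _ x))
  · ext x
    rw [mul_apply_eq_comp, hR]
    refine Submodule.reflection_mem_subspace_orthogonalComplement_eq_neg ?_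
    rw [Submodule.orthogonal_closure, Submodule.mem_orthogonal]
    rintro _ ⟨y, rfl⟩
    have h0 : P (N x) = 0 := by
      rw [← mul_apply_eq_comp, h]; rfl
    have h1 := hP.isSymmetric y (N x)
    simpa [h0] using h1

/-- The decomposition `N = R G ≥ 0` of a selfadjoint operator `G` with a symmetry `R` that commutes
with `G`. -/
theorem exists_symmetry_mul_nonneg {G : E →L[ℂ] E} (hG : IsSelfAdjoint G) :
    ∃ R : E →L[ℂ] E, IsSelfAdjoint R ∧ R * R = 1 ∧ R * G = G * R ∧ (R * G).IsPositive := by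
  have hp : (G⁺).IsPositive :=
    (ContinuousLinearMap.nonneg_iff_isPositive _).1 (CFC.posPart_nonneg G)
  have hn : (G⁻).IsPositive :=
    (ContinuousLinearMap.nonneg_iff_isPositive _).1 (CFC.negPart_nonneg G)
  obtain ⟨R, hR, hRR, hRp, hRn⟩ := exists_symmetry_mul_eq hp (CFC.posPart_mul_negPart G)
  -- Thus `R * G` is the absolute value of `G`; its selfadjointness is what makes `R` commute with
  -- `G`.
  have hRG : R * G = G⁺ + G⁻ := by
    conv_lhs => rw [← CFC.posPart_sub_negPart G hG]
    rw [mul_sub, hRp, hRn, sub_neg_eq_add]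
  have hpos : (R * G).IsPositive := by rw [hRG]; exact hp.add hn
  refine ⟨R, hR, hRR, ?_, hpos⟩
  have := hpos.isSelfAdjoint.star_eq
  rw [star_mul, hR.star_eq, hG.star_eq] at this
  exact this.symm

end Hilbert

/-! ### Elementary properties of the indefinite inner product. -/

section Form

variable {H : Type*} [NormedAddCommGroup H] [InnerProductSpace ℂ H] [CompleteSpace H] [KreinSpace H]
variable {K : Type*} [NormedAddCommGroup K] [InnerProductSpace ℂ K] [CompleteSpace K] [KreinSpace K]

theorem form_add_left (ξ ξ' η : H) : form (ξ + ξ') η = form ξ η + form ξ' η := by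
  simp [form]

theorem form_add_right (ξ η η' : H) : form ξ (η + η') = form ξ η + form ξ η' := by
  simp [form]

theorem form_smul_left (c : ℂ) (ξ η : H) : form (c • ξ) η = c * form ξ η := by
  simp [form]

theorem form_smul_right (c : ℂ) (ξ η : H) :
    form ξ (c • η) = (starRingEnd ℂ) c * form ξ η := by
  simp [form, mul_comm]

theorem form_neg_left (ξ η : H) : form (-ξ) η = -form ξ η := by
  simp [form]

@[simp]
theorem form_zero_left (η : H) : form 0 η = 0 := by
  simp [form]

@[simp]
theorem form_zero_right (ξ : H) : form ξ 0 = 0 := by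
  simp [form]

theorem conj_form (ξ η : H) : (starRingEnd ℂ) (form ξ η) = form η ξ := by
  rw [form_eq_inner_J_left η ξ, form, inner_conj_symm]

theorem form_sharp_left (T : H →L[ℂ] K) (ξ : H) (η : K) : form (sharp T η) ξ = form η (T ξ) := by
  rw [← conj_form, ← form_sharp, conj_form]

theorem form_J_left (ξ η : H) : form (J ξ) η = inner ℂ η ξ := by
  rw [form, J_J]

theorem norm_J_apply (ξ : H) : ‖(J ξ : H)‖ = ‖ξ‖ := by
  have h : inner ℂ (J ξ : H) (J ξ) = inner ℂ ξ ξ := by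
    rw [← form_eq_inner_J_left, form_J_left]
  rw [norm_eq_sqrt_re_inner (𝕜 := ℂ), h, ← norm_eq_sqrt_re_inner]

theorem ext_form {ξ ξ' : H} (h : ∀ η, form ξ η = form ξ' η) : ξ = ξ' := by
  have h1 : (J ξ : H) = J ξ' := ext_inner_left ℂ h
  rw [← J_J ξ, h1, J_J]

theorem ext_form_of_denseRange {V : Type*} {e : V → H} (he : DenseRange e) {ξ ξ' : H}
    (h : ∀ v, form ξ (e v) = form ξ' (e v)) : ξ = ξ' := by
  refine ext_form fun η => ?_
  refine he.induction_on (p := fun η => form ξ η = form ξ' η) η ?_ h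
  unfold form
  exact isClosed_eq (by fun_prop) (by fun_prop)

end Form

/-! ### Kreĭn spaces from selfadjoint operators; Gram operators. -/

section Hilbert

/-- A selfadjoint operator `G` induces a Kreĭn space, and operators having an adjoint with respect to
the form `⟨G ·, ·⟩` descend to bounded operators on it. -/
theorem exists_kreinSpace_of_isSelfAdjoint {E : Type u} [NormedAddCommGroup E]
    [InnerProductSpace ℂ E] [CompleteSpace E] {G : E →L[ℂ] E} (hG : IsSelfAdjoint G) :
    ∃ (K : Type max u w) (_ : NormedAddCommGroup K) (_ : InnerProductSpace ℂ K)
      (_ : CompleteSpace K) (_ : KreinSpace K) (P : E →L[ℂ] K),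
      DenseRange P ∧ (∀ x y, form (P x) (P y) = inner ℂ y (G x)) ∧
      ∀ S S' : E →L[ℂ] E, (∀ x y, inner ℂ y (G (S x)) = inner ℂ (S' y) (G x)) →
        ∃ S₁ : K →L[ℂ] K, ∀ x, S₁ (P x) = P (S x) := by
  obtain ⟨R, hR, hRR, hRG, hN⟩ := exists_symmetry_mul_nonneg hG
  have hRs : ∀ x y, inner ℂ (R x) y = inner ℂ x (R y) :=
    (ContinuousLinearMap.isSelfAdjoint_iff_isSymmetric.1 hR)
  have hRR' : ∀ x, R (R x) = x := fun x => congrArg (fun S : E →L[ℂ] E => S x) hRR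
  have hRG' : ∀ x, R (G x) = G (R x) := fun x => congrArg (fun S : E →L[ℂ] E => S x) hRG
  let c : PreInnerProductSpace.Core ℂ E :=
    { inner := fun x y => inner ℂ x ((R * G) y)
      conj_inner_symm := fun x y => by
        rw [inner_conj_symm]
        exact hN.isSymmetric x y
      re_inner_nonneg := fun x => hN.re_inner_nonneg_right x
      add_left := fun x y z => inner_add_left _ _ _
      smul_left := fun x y r => inner_smul_left _ _ _ }
  obtain ⟨K, _, _, _, ι, hd, hι⟩ := exists_hilbert_completion.{u, w} c
  replace hι : ∀ x y, inner ℂ (ι x) (ι y) = inner ℂ x (R (G y)) := hι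
  have hιR : ∀ x y, inner ℂ (ι (R x)) (ι (R y)) = inner ℂ (ι x) (ι y) := fun x y => by
    rw [hι, hι, hRs, ← hRG', hRR', hRG']
  have hbound : ∀ x, ‖ι x‖ ≤ √‖R * G‖ * ‖x‖ := fun x => by
    rw [norm_eq_sqrt_re_inner (𝕜 := ℂ), hι, ← Real.sqrt_sq (norm_nonneg x),
      ← Real.sqrt_mul (norm_nonneg _)]
    refine Real.sqrt_le_sqrt ?_
    calc RCLike.re (inner ℂ x ((R * G) x)) ≤ ‖x‖ * ‖(R * G) x‖ := re_inner_le_norm _ _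
      _ ≤ ‖x‖ * (‖R * G‖ * ‖x‖) := by gcongr; exact (R * G).le_opNorm x
      _ = ‖R * G‖ * ‖x‖ ^ 2 := by ring
  let P : E →L[ℂ] K := ι.mkContinuous _ hbound
  obtain ⟨J₀, hJ⟩ := exists_extension hd (ι ∘ₗ R.toLinearMap) ⟨1, fun x => by
    rw [one_mul, norm_eq_sqrt_re_inner (𝕜 := ℂ), norm_eq_sqrt_re_inner (𝕜 := ℂ) (ι x), ← hιR]
    rfl⟩
  replace hJ : ∀ x, J₀ (ι x) = ι (R x) := hJ
  have hJJ : J₀ ∘L J₀ = ContinuousLinearMap.id ℂ K := by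
    refine DFunLike.coe_injective (hd.equalizer (by fun_prop) (by fun_prop) (funext fun x => ?_))
    simp [hJ, hRR']
  have hJsymm : ∀ x y, inner ℂ (J₀ x) y = inner ℂ x (J₀ y) := fun x y => by
    refine hd.induction_on₂ (p := fun x y => inner ℂ (J₀ x) y = inner ℂ x (J₀ y)) ?_ ?_ x y
    · exact isClosed_eq (by fun_prop) (by fun_prop)
    · intro x y
      rw [hJ, hJ, ← hιR, hRR']
  have hJadj : ContinuousLinearMap.adjoint J₀ = J₀ :=
    ((ContinuousLinearMap.eq_adjoint_iff _ _).2 hJsymm).symm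
  refine ⟨K, _, _, _, ⟨J₀, hJadj, hJJ⟩, P, hd, fun x y => ?_, fun S S' hS => ?_⟩
  · change inner ℂ (ι y) (J₀ (ι x)) = _
    rw [hJ, hι, ← hRG', hRR']
  · have hPi : ∀ x y, inner ℂ (P x) (P y) = inner ℂ x (R (G y)) := hι
    have hflip : ∀ x y, inner ℂ (G (S x)) y = inner ℂ (G x) (S' y) := fun x y => by
      rw [← inner_conj_symm, hS, inner_conj_symm]
    have hGs : ∀ x y, inner ℂ (G x) y = inner ℂ x (G y) :=
      (ContinuousLinearMap.isSelfAdjoint_iff_isSymmetric.1 hG)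
    -- Conjugating the `G`-adjoint `S'` by `R` gives an adjoint of `S` for the positive form of `R *
    -- G`, because `R` commutes with `G` and `R * R = 1`.
    have hbd := norm_map_le_of_adjoint P S (R * S' * R) fun x y => by
      rw [hPi, hPi]
      simp only [mul_apply_eq_comp]
      rw [hRG' (R _), hRR', hRG' y, ← hGs, hflip, hGs]
    exact exists_extension hd (ι ∘ₗ S.toLinearMap) hbd

/-- A bounded sesquilinear form is given by a bounded operator. -/
theorem exists_gram_operator {V E : Type*} [AddCommGroup V] [Module ℂ V] [NormedAddCommGroup E]
    [InnerProductSpace ℂ E] [CompleteSpace E] {ι : V →ₗ[ℂ] E} (hd : DenseRange ι)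
    (D : V →ₗ⋆[ℂ] V →ₗ[ℂ] ℂ) {C : ℝ} (hC : 0 ≤ C) (hD : ∀ g f, ‖D g f‖ ≤ C * ‖ι g‖ * ‖ι f‖) :
    ∃ G : E →L[ℂ] E, ∀ f g, inner ℂ (ι g) (G (ι f)) = D g f := by
  let r : V → E := fun g => (InnerProductSpace.toDual ℂ E).symm ((D g).extendOfNorm ι)
  have hr : ∀ g f, inner ℂ (r g) (ι f) = D g f := fun g f => by
    rw [InnerProductSpace.toDual_symm_apply, LinearMap.extendOfNorm_eq hd ⟨_, hD g⟩]
  have hext : ∀ x y : E, (∀ f, inner ℂ x (ι f) = inner ℂ y (ι f)) → x = y := fun x y h => by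
    refine ext_inner_right ℂ fun z => ?_
    exact hd.induction_on (p := fun z => inner ℂ x z = inner ℂ y z) z
      (isClosed_eq (by fun_prop) (by fun_prop)) h
  -- Riesz representation is antilinear and so is `D` in `g`; the composite is linear.
  let r' : V →ₗ[ℂ] E :=
    { toFun := r
      map_add' := fun g g' => hext _ _ fun f => by simp [hr]
      map_smul' := fun c g => hext _ _ fun f => by simp [hr, mul_comm] }
  obtain ⟨G, hG⟩ := exists_extension hd r' ⟨C, fun g => by
    change ‖r g‖ ≤ _
    rw [LinearIsometryEquiv.norm_map]
    exact LinearMap.opNorm_extendOfNorm_le hd (by positivity) (hD g)⟩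
  refine ⟨ContinuousLinearMap.adjoint G, fun f g => ?_⟩
  rw [ContinuousLinearMap.adjoint_inner_right, hG]
  exact hr g f

end Hilbert

/-! ### Sesquilinear forms of kernels and domination. -/

section Kernels

variable {X : Type*}
variable {H : Type*} [NormedAddCommGroup H] [InnerProductSpace ℂ H] [CompleteSpace H] [KreinSpace H]

theorem kernelForm_eq_sum (K : X → X → H →L[ℂ] H) (f g : X →₀ H) :
    kernelForm K f g = g.sum fun x η => f.sum fun y ξ => form (K x y ξ) η := rfl

theorem kernelForm_add_left (K : X → X → H →L[ℂ] H) (f f' g : X →₀ H) :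
    kernelForm K (f + f') g = kernelForm K f g + kernelForm K f' g := by
  classical
  simp only [kernelForm_eq_sum]
  rw [← Finsupp.sum_add]
  refine Finsupp.sum_congr fun x _ => ?_
  exact Finsupp.sum_add_index' (by simp) (by simp [form_add_left])

theorem kernelForm_add_right (K : X → X → H →L[ℂ] H) (f g g' : X →₀ H) :
    kernelForm K f (g + g') = kernelForm K f g + kernelForm K f g' := by
  classical
  simp only [kernelForm_eq_sum]
  refine Finsupp.sum_add_index' (by simp) fun x η η' => ?_
  simp only [form_add_right, Finsupp.sum_add]

theorem kernelForm_smul_left (K : X → X → H →L[ℂ] H) (c : ℂ) (f g : X →₀ H) :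
    kernelForm K (c • f) g = c * kernelForm K f g := by
  simp only [kernelForm_eq_sum]
  rw [Finsupp.sum, Finsupp.sum, Finset.mul_sum]
  refine Finset.sum_congr rfl fun x _ => ?_
  rw [Finsupp.sum_smul_index' (by simp), Finsupp.sum, Finsupp.sum, Finset.mul_sum]
  simp only [map_smul, form_smul_left]

theorem kernelForm_smul_right (K : X → X → H →L[ℂ] H) (c : ℂ) (f g : X →₀ H) :
    kernelForm K f (c • g) = (starRingEnd ℂ) c * kernelForm K f g := by
  simp only [kernelForm_eq_sum]
  rw [Finsupp.sum_smul_index' (by simp)]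
  simp only [form_smul_right, Finsupp.sum, Finset.mul_sum]

/-- The form `[f, g]_K` as a sesquilinear map, antilinear in its first argument `g`. -/
def kernelSesq (K : X → X → H →L[ℂ] H) : (X →₀ H) →ₗ⋆[ℂ] (X →₀ H) →ₗ[ℂ] ℂ :=
  LinearMap.mk₂'ₛₗ (starRingEnd ℂ) (RingHom.id ℂ) (fun g f => kernelForm K f g)
    (fun g g' f => kernelForm_add_right K f g g') (fun c g f => kernelForm_smul_right K c f g)
    (fun g f f' => kernelForm_add_left K f f' g) (fun c g f => kernelForm_smul_left K c f g)

theorem kernelSesq_apply (K : X → X → H →L[ℂ] H) (f g : X →₀ H) :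
    kernelSesq K g f = kernelForm K f g := rfl

theorem kernelForm_single_single (K : X → X → H →L[ℂ] H) (x y : X) (ξ η : H) :
    kernelForm K (Finsupp.single y ξ) (Finsupp.single x η) = form (K x y ξ) η := by
  rw [kernelForm_eq_sum, Finsupp.sum_single_index (by simp), Finsupp.sum_single_index (by simp)]

theorem kernelForm_add (K K' : X → X → H →L[ℂ] H) (f g : X →₀ H) :
    kernelForm (K + K') f g = kernelForm K f g + kernelForm K' f g := by
  simp [kernelForm, form_add_left, Finset.sum_add_distrib]

theorem kernelForm_neg (K : X → X → H →L[ℂ] H) (f g : X →₀ H) :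
    kernelForm (-K) f g = -kernelForm K f g := by
  simp [kernelForm, form_neg_left]

theorem IsHermitianKernel.form_apply {K : X → X → H →L[ℂ] H} (hK : IsHermitianKernel K) (x y : X)
    (ξ η : H) : form (K x y ξ) η = form ξ (K y x η) := by
  rw [form_sharp, ← hK]

theorem isHermitianKernel_of_form {K : X → X → H →L[ℂ] H}
    (hK : ∀ x y ξ η, form (K x y ξ) η = form ξ (K y x η)) : IsHermitianKernel K :=
  fun x y => eq_sharp _ _ (hK y x)

theorem IsHermitianKernel.add {K K' : X → X → H →L[ℂ] H} (hK : IsHermitianKernel K)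
    (hK' : IsHermitianKernel K') : IsHermitianKernel (K + K') :=
  isHermitianKernel_of_form fun x y ξ η => by
    simp [form_add_left, form_add_right, hK.form_apply, hK'.form_apply]

theorem IsHermitianKernel.neg {K : X → X → H →L[ℂ] H} (hK : IsHermitianKernel K) :
    IsHermitianKernel (-K) :=
  isHermitianKernel_of_form fun x y ξ η => by
    simp only [Pi.neg_apply, neg_apply, form_neg_left, hK.form_apply]
    simp [form]

theorem IsHermitianKernel.conj_kernelForm {K : X → X → H →L[ℂ] H} (hK : IsHermitianKernel K)
    (f g : X →₀ H) : (starRingEnd ℂ) (kernelForm K f g) = kernelForm K g f := by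
  simp only [kernelForm, map_sum, conj_form]
  rw [Finset.sum_comm]
  exact Finset.sum_congr rfl fun y _ => Finset.sum_congr rfl fun x _ => (hK.form_apply _ _ _ _).symm

theorem kernelForm_psi {S : Type*} {φ : S → X → X} {a b : S} {K : X → X → H →L[ℂ] H}
    (h : ∀ x y, K x (φ a y) = K (φ b x) y) (f g : X →₀ H) :
    kernelForm K (psi φ a f) g = kernelForm K f (psi φ b g) := by
  classical
  simp only [kernelForm_eq_sum, psi, Finsupp.lmapDomain_apply]
  rw [Finsupp.sum_mapDomain_index (by simp) (by simp [form_add_right, Finsupp.sum_add])]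
  refine Finsupp.sum_congr fun x _ => ?_
  rw [Finsupp.sum_mapDomain_index (by simp) (by simp [form_add_left])]
  simp [h]

/-- A positive definite kernel makes the finitely supported functions a semi-inner product space. -/
abbrev IsPosDefKernel.core {L : X → X → H →L[ℂ] H} (hL : IsPosDefKernel L) :
    PreInnerProductSpace.Core ℂ (X →₀ H) where
  inner g f := kernelForm L f g
  conj_inner_symm _ _ := hL.1.conj_kernelForm _ _
  re_inner_nonneg f := (Complex.le_def.1 (hL.2 f)).1
  add_left g g' f := kernelForm_add_right L f g g'
  smul_left g f c := kernelForm_smul_right L c f g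

theorem IsPosDefKernel.norm_kernelForm_le {L : X → X → H →L[ℂ] H} (hL : IsPosDefKernel L)
    (f g : X →₀ H) : ‖kernelForm L f g‖ ≤ kernelSeminorm L g * kernelSeminorm L f :=
  InnerProductSpace.Core.norm_inner_le_norm (𝕜 := ℂ) (c := hL.core) g f

theorem kernelSeminorm_le_of_le {L M : X → X → H →L[ℂ] H} {f : X →₀ H}
    (h : (kernelForm M f f).re ≤ 2 * (kernelForm L f f).re) :
    kernelSeminorm M f ≤ √2 * kernelSeminorm L f := by
  rw [kernelSeminorm, kernelSeminorm, ← Real.sqrt_mul (by norm_num)]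
  exact Real.sqrt_le_sqrt h

-- Both `L + K` and `L - K` are positive definite and at most `2L`, so each satisfies Cauchy–Schwarz
-- with constant `2` relative to `L`. Half their difference is `K`.
open scoped ComplexOrder in
theorem norm_kernelForm_le_of_kernelLE {K L : X → X → H →L[ℂ] H} (hL : IsPosDefKernel L)
    (hK : IsHermitianKernel K) (h₁ : KernelLE (-L) K) (h₂ : KernelLE K L) (f g : X →₀ H) :
    ‖kernelForm K f g‖ ≤ 2 * kernelSeminorm L g * kernelSeminorm L f := by
  have hp : IsPosDefKernel (L + K) := ⟨hL.1.add hK, fun f => by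
    have := h₁ f
    rw [kernelForm_neg] at this
    rw [kernelForm_add]
    exact neg_le_iff_add_nonneg'.1 this⟩
  have hm : IsPosDefKernel (L + -K) := ⟨hL.1.add hK.neg, fun f => by
    rw [kernelForm_add, kernelForm_neg, ← sub_eq_add_neg]
    exact sub_nonneg.2 (h₂ f)⟩
  have hre₁ : ∀ f, -(kernelForm L f f).re ≤ (kernelForm K f f).re := fun f => by
    have := (Complex.le_def.1 (h₁ f)).1
    rwa [kernelForm_neg, Complex.neg_re] at this
  have hre₂ : ∀ f, (kernelForm K f f).re ≤ (kernelForm L f f).re := fun f =>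
    (Complex.le_def.1 (h₂ f)).1
  have hps : ∀ f, kernelSeminorm (L + K) f ≤ √2 * kernelSeminorm L f := fun f =>
    kernelSeminorm_le_of_le (by
      rw [kernelForm_add, Complex.add_re]; linarith [hre₂ f])
  have hms : ∀ f, kernelSeminorm (L + -K) f ≤ √2 * kernelSeminorm L f := fun f =>
    kernelSeminorm_le_of_le (by
      rw [kernelForm_add, kernelForm_neg, Complex.add_re, Complex.neg_re]; linarith [hre₁ f])
  have hbound : ∀ M : X → X → H →L[ℂ] H, IsPosDefKernel M →
      (∀ f, kernelSeminorm M f ≤ √2 * kernelSeminorm L f) →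
      ‖kernelForm M f g‖ ≤ 2 * kernelSeminorm L g * kernelSeminorm L f := fun M hM hle => by
    calc ‖kernelForm M f g‖ ≤ kernelSeminorm M g * kernelSeminorm M f := hM.norm_kernelForm_le f g
      _ ≤ (√2 * kernelSeminorm L g) * (√2 * kernelSeminorm L f) :=
        mul_le_mul (hle g) (hle f) (Real.sqrt_nonneg _)
          (mul_nonneg (Real.sqrt_nonneg _) (Real.sqrt_nonneg _))
      _ = (√2 * √2) * kernelSeminorm L g * kernelSeminorm L f := by ring
      _ = 2 * kernelSeminorm L g * kernelSeminorm L f := by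
        rw [Real.mul_self_sqrt (by norm_num)]
  have h2 : (2 : ℂ) * kernelForm K f g = kernelForm (L + K) f g - kernelForm (L + -K) f g := by
    rw [kernelForm_add, kernelForm_add, kernelForm_neg]; ring
  have h3 : 2 * ‖kernelForm K f g‖ ≤ ‖kernelForm (L + K) f g‖ + ‖kernelForm (L + -K) f g‖ := by
    have := norm_sub_le (kernelForm (L + K) f g) (kernelForm (L + -K) f g)
    rwa [← h2, norm_mul, Complex.norm_ofNat] at this
  linarith [hbound _ hp hps, hbound _ hm hms]

/-- A kernel that factors through a Hilbert space. -/
theorem kernelForm_eq_inner_lsum {E : Type*} [NormedAddCommGroup E] [InnerProductSpace ℂ E]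
    {K : X → X → H →L[ℂ] H} (V : X → H →ₗ[ℂ] E) (Q : E →L[ℂ] E)
    (h : ∀ x y ξ η, form (K x y ξ) η = inner ℂ (V x η) (Q (V y ξ))) (f g : X →₀ H) :
    kernelForm K f g = inner ℂ (Finsupp.lsum ℂ V g) (Q (Finsupp.lsum ℂ V f)) := by
  simp only [kernelForm, h, Finsupp.lsum_apply, Finsupp.sum, map_sum, sum_inner, inner_sum]
  exact Finset.sum_comm

end Kernels

/-! ### The two implications. -/

section Dilation

variable {A : Type u} [Ring A] [StarRing A] [Algebra ℂ A]
variable {H : Type v} [NormedAddCommGroup H] [InnerProductSpace ℂ H] [CompleteSpace H] [KreinSpace H]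

open scoped ComplexOrder in
/-- A Stinespring dilation provides a `φ`-bounded positive definite kernel dominating `K_T`. -/
theorem IsStinespringDilation.exists_dominating_kernel
    {K : Type*} [NormedAddCommGroup K] [InnerProductSpace ℂ K] [CompleteSpace K] [KreinSpace K]
    {T : A →ₗ[ℂ] (H →L[ℂ] H)} {π : A →ₙₐ[ℂ] (K →L[ℂ] K)} {B : H →L[ℂ] K}
    (h : IsStinespringDilation T π B) :
    ∃ L : A → A → H →L[ℂ] H, L ∈ boundedPosDefKernels (starAction (A := A)) ∧
      KernelLE (-L) (mapKernel T) ∧ KernelLE (mapKernel T) L := by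
  let V : A → H →ₗ[ℂ] K := fun y => (π (star y) ∘L B).toLinearMap
  let L : A → A → H →L[ℂ] H := fun x y => sharp B ∘L π x ∘L J ∘L π (star y) ∘L B
  have hπ : ∀ a ξ η, form (π a ξ) η = form ξ (π (star a) η) := fun a ξ η => by
    rw [form_sharp, h.selfadjoint]
  have hL₀ : ∀ x y ξ η, form (L x y ξ) η = inner ℂ (V x η) (V y ξ) := fun x y ξ η => by
    change form (sharp B (π x (J (π (star y) (B ξ))))) η = inner ℂ (π (star x) (B η)) _
    rw [form_sharp_left, hπ, form_J_left]
    rfl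
  have hT₀ : ∀ x y ξ η, form (mapKernel T x y ξ) η = inner ℂ (V x η) (J (V y ξ)) :=
    fun x y ξ η => by
      rw [mapKernel, h.dilation, map_mul]
      change form (sharp B (π x (π (star y) (B ξ)))) η = form (π (star y) (B ξ)) (π (star x) (B η))
      rw [form_sharp_left, hπ]
  let U : (A →₀ H) →ₗ[ℂ] K := Finsupp.lsum ℂ V
  have hL : ∀ f g, kernelForm L f g = inner ℂ (U g) (U f) :=
    kernelForm_eq_inner_lsum V (ContinuousLinearMap.id ℂ K) hL₀
  have hT : ∀ f g, kernelForm (mapKernel T) f g = inner ℂ (U g) (J (U f)) :=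
    kernelForm_eq_inner_lsum V J hT₀
  have hLL : ∀ f, kernelForm L f f = ((‖U f‖ ^ 2 : ℝ) : ℂ) := fun f => by
    rw [hL, inner_self_eq_norm_sq_to_K]; simp
  have hsemi : ∀ f, kernelSeminorm L f = ‖U f‖ := fun f => by
    rw [kernelSeminorm, hLL, Complex.ofReal_re, Real.sqrt_sq (norm_nonneg _)]
  have hTreal : ∀ f, ∃ r : ℝ, kernelForm (mapKernel T) f f = r ∧ |r| ≤ ‖U f‖ ^ 2 := fun f => by
    have h1 : kernelForm (mapKernel T) f f = form (U f) (U f) := hT f f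
    obtain ⟨r, hr⟩ := Complex.conj_eq_iff_real.1 (conj_form (U f) (U f))
    refine ⟨r, h1.trans hr, ?_⟩
    rw [← Real.norm_eq_abs, ← Complex.norm_real, ← hr, sq]
    refine (norm_inner_le_norm _ _).trans ?_
    rw [norm_J_apply]
  -- Here `(x a*)* = a x*`, so shifting the index by `a` becomes left multiplication by `π a`.
  have hU : ∀ a f, U (psi starAction a f) = π a (U f) := fun a f => by
    induction f using Finsupp.induction_linear with
    | zero => simp
    | add f g hf hg => simp only [map_add, hf, hg]
    | single x ξ =>
      simp [U, V, psi, starAction, Finsupp.lsum_single, map_mul]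
  refine ⟨L, ⟨⟨isHermitianKernel_of_form fun x y ξ η => ?_, fun f => ?_⟩, fun a => ⟨‖π a‖, fun f => ?_⟩⟩,
    fun f => ?_, fun f => ?_⟩
  · rw [hL₀, ← conj_form, hL₀, inner_conj_symm]
  · rw [hLL]
    exact_mod_cast sq_nonneg ‖U f‖
  · rw [hsemi, hsemi, hU]
    exact (π a).le_opNorm _
  · obtain ⟨r, hr, hle⟩ := hTreal f
    rw [kernelForm_neg, hLL, hr]
    exact_mod_cast (abs_le.1 hle).1
  · obtain ⟨r, hr, hle⟩ := hTreal f
    rw [hLL, hr]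
    exact_mod_cast (abs_le.1 hle).2

theorem isHermitianKernel_mapKernel {T : A →ₗ[ℂ] (H →L[ℂ] H)} (hT : IsHermitianMap T) :
    IsHermitianKernel (mapKernel T) := fun x y => by
  rw [mapKernel, mapKernel, ← hT, star_mul, star_star]

/-- Because `x (y a*)* = (x a) y*`, the maps `ψ_a` and `ψ_{a*}` are adjoint for `K_T`. This bounds
`π a` and later gives `π(a*) = π(a)♯`. -/
theorem mapKernel_psi (T : A →ₗ[ℂ] (H →L[ℂ] H)) (a : A) (f g : A →₀ H) :
    kernelForm (mapKernel T) (psi starAction a f) g =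
      kernelForm (mapKernel T) f (psi starAction (star a) g) :=
  kernelForm_psi (fun x y => by simp [mapKernel, starAction, mul_assoc]) f g

/-- The Kreĭn space induced by a hermitian kernel dominated by a positive definite kernel, with the
bounded operators induced by maps `ψ_a` that are bounded for the dominating kernel and have an
adjoint `ψ_b`. -/
theorem exists_induced_kreinSpace {X : Type u} {M L : X → X → H →L[ℂ] H} (hL : IsPosDefKernel L)
    (hM : IsHermitianKernel M) (h₁ : KernelLE (-L) M) (h₂ : KernelLE M L) :
    ∃ (K : Type max u v w) (_ : NormedAddCommGroup K) (_ : InnerProductSpace ℂ K)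
      (_ : CompleteSpace K) (_ : KreinSpace K) (ι : (X →₀ H) →ₗ[ℂ] K),
      DenseRange ι ∧ (∀ f g, form (ι f) (ι g) = kernelForm M f g) ∧
      (∃ C, 0 ≤ C ∧ ∀ f, ‖ι f‖ ≤ C * kernelSeminorm L f) ∧
      ∀ S S' : (X →₀ H) →ₗ[ℂ] (X →₀ H),
        (∃ C, ∀ f, kernelSeminorm L (S f) ≤ C * kernelSeminorm L f) →
        (∃ C, ∀ f, kernelSeminorm L (S' f) ≤ C * kernelSeminorm L f) →
        (∀ f g, kernelForm M (S f) g = kernelForm M f (S' g)) →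
        ∃ S₁ : K →L[ℂ] K, ∀ f, S₁ (ι f) = ι (S f) := by
  obtain ⟨E, _, _, _, j, hjd, hj⟩ := exists_hilbert_completion.{max u v, w} hL.core
  have hjn : ∀ f, ‖j f‖ = kernelSeminorm L f := norm_eq_sqrt_core_inner hj
  obtain ⟨G, hG⟩ := exists_gram_operator hjd (kernelSesq M) (C := 2) (by norm_num) fun g f => by
    rw [hjn, hjn]
    exact norm_kernelForm_le_of_kernelLE hL hM h₁ h₂ f g
  simp only [kernelSesq_apply] at hG
  have hGs : IsSelfAdjoint G := by
    rw [ContinuousLinearMap.isSelfAdjoint_iff_isSymmetric]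
    intro x y
    refine hjd.induction_on₂ (p := fun x y => inner ℂ (G x) y = inner ℂ x (G y)) ?_ ?_ x y
    · exact isClosed_eq (by fun_prop) (by fun_prop)
    · intro f g
      rw [← inner_conj_symm, hG, hG, hM.conj_kernelForm]
  obtain ⟨K, iN, iI, iC, iK, P, hPd, hP, hlift⟩ := exists_kreinSpace_of_isSelfAdjoint.{max u v w, w} hGs
  refine ⟨K, iN, iI, iC, iK, P.toLinearMap ∘ₗ j, hPd.comp hjd P.continuous, fun f g => ?_,
    ⟨‖P‖, norm_nonneg _, fun f => ?_⟩, fun S S' hS hS' hSS' => ?_⟩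
  · exact (hP _ _).trans (hG f g)
  · rw [← hjn]
    exact P.le_opNorm _
  · have hext : ∀ S : (X →₀ H) →ₗ[ℂ] (X →₀ H),
        (∃ C, ∀ f, kernelSeminorm L (S f) ≤ C * kernelSeminorm L f) →
        ∃ S₁ : E →L[ℂ] E, ∀ f, S₁ (j f) = j (S f) := fun S hS =>
      exists_extension hjd (j ∘ₗ S) (by simpa [hjn] using hS)
    obtain ⟨S₁, hS₁⟩ := hext S hS
    obtain ⟨S₂, hS₂⟩ := hext S' hS'
    obtain ⟨S₃, hS₃⟩ := hlift S₁ S₂ fun x y => by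
      refine hjd.induction_on₂
        (p := fun x y => inner ℂ y (G (S₁ x)) = inner ℂ (S₂ y) (G x)) ?_ ?_ x y
      · exact isClosed_eq (by fun_prop) (by fun_prop)
      · intro f g
        rw [hS₁, hS₂, hG, hG, hSS']
    exact ⟨S₃, fun f => (hS₃ _).trans (congrArg P (hS₁ f))⟩

/-- A hermitian map whose kernel is dominated by a `φ`-bounded positive definite kernel has a minimal
Stinespring dilation. -/
theorem hasMinimalStinespringDilation_of_dominating_kernel [StarModule ℂ A] {T : A →ₗ[ℂ] (H →L[ℂ] H)}
    (hT : IsHermitianMap T) {L : A → A → H →L[ℂ] H}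
    (hL : L ∈ boundedPosDefKernels (starAction (A := A))) (h₁ : KernelLE (-L) (mapKernel T))
    (h₂ : KernelLE (mapKernel T) L) : HasMinimalStinespringDilation.{u, v, max u v w} T := by
  obtain ⟨K, _, _, _, _, ι, hd, hι, ⟨C, hC, hιC⟩, hlift⟩ := exists_induced_kreinSpace.{u, v, w} hL.1
    (isHermitianKernel_mapKernel hT) h₁ h₂
  choose p hp using fun a => hlift (psi starAction a) (psi starAction (star a)) (hL.2 a)
    (hL.2 (star a)) (mapKernel_psi T a)
  have hext : ∀ S S' : K →L[ℂ] K, (∀ x ξ, S (ι (Finsupp.single x ξ)) = S' (ι (Finsupp.single x ξ))) →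
      S = S' := fun S S' h => by
    refine DFunLike.coe_injective (hd.equalizer S.continuous S'.continuous ?_)
    have h' : S.toLinearMap ∘ₗ ι = S'.toLinearMap ∘ₗ ι :=
      Finsupp.lhom_ext h
    exact congrArg DFunLike.coe h'
  have hext' : ∀ k k' : K, (∀ x ξ, form k (ι (Finsupp.single x ξ)) =
      form k' (ι (Finsupp.single x ξ))) → k = k' := fun k k' h => by
    refine ext_form_of_denseRange hd fun f => ?_
    induction f using Finsupp.induction_linear with
    | zero => simp
    | add f g hf hg => rw [map_add, form_add_right, form_add_right, hf, hg]
    | single x ξ => exact h x ξ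
  have hps : ∀ a x ξ, p a (ι (Finsupp.single x ξ)) = ι (Finsupp.single (x * star a) ξ) :=
    fun a x ξ => by simp [hp, psi, starAction]
  have hform : ∀ x y ξ η, form (ι (Finsupp.single y ξ)) (ι (Finsupp.single x η)) =
      form (T (x * star y) ξ) η := fun x y ξ η => by
    rw [hι, kernelForm_single_single, mapKernel]
  -- Multiplicativity already holds on indices. Linearity in `a` does not: `ξ_{x(a+b)*}` is not a
  -- sum of point functions. It holds only in `K`, where testing against the form reduces it to
  -- linearity of `T`.
  let π : A →ₙₐ[ℂ] (K →L[ℂ] K) :=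
    { toFun := p
      map_smul' := fun c a => hext _ _ fun x ξ => hext' _ _ fun y η => by
        simp [hps, hform, form_smul_left]
      map_zero' := hext _ _ fun x ξ => hext' _ _ fun y η => by simp [hps, hform]
      map_add' := fun a b => hext _ _ fun x ξ => hext' _ _ fun y η => by
        simp [hps, hform, form_add_left, mul_add]
      map_mul' := fun a b => hext _ _ fun x ξ => by simp [hps, mul_assoc] }
  have hπ : ∀ a x ξ, π a (ι (Finsupp.single x ξ)) = ι (Finsupp.single (x * star a) ξ) := hps
  let B : H →L[ℂ] K := (ι ∘ₗ Finsupp.lsingle (1 : A)).mkContinuous (C * √‖(J : H →L[ℂ] H) ∘L L 1 1‖)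
    fun ξ => by
      refine (hιC _).trans ?_
      rw [mul_assoc]
      refine mul_le_mul_of_nonneg_left ?_ hC
      rw [kernelSeminorm, Finsupp.lsingle_apply, kernelForm_single_single,
        ← Real.sqrt_sq (norm_nonneg ξ), ← Real.sqrt_mul (norm_nonneg _)]
      refine Real.sqrt_le_sqrt ?_
      calc (form (L 1 1 ξ) ξ).re ≤ ‖ξ‖ * ‖((J : H →L[ℂ] H) ∘L L 1 1) ξ‖ :=
          re_inner_le_norm (𝕜 := ℂ) ξ (((J : H →L[ℂ] H) ∘L L 1 1) ξ)
        _ ≤ ‖ξ‖ * (‖(J : H →L[ℂ] H) ∘L L 1 1‖ * ‖ξ‖) := by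
          gcongr; exact ContinuousLinearMap.le_opNorm _ _
        _ = ‖(J : H →L[ℂ] H) ∘L L 1 1‖ * ‖ξ‖ ^ 2 := by ring
  have hB : ∀ ξ, B ξ = ι (Finsupp.single 1 ξ) := fun _ => rfl
  refine ⟨K, _, _, _, _, π, B, ⟨fun a => eq_sharp _ _ fun k l => ?_, fun a => ?_⟩, ?_⟩
  · refine hd.induction_on₂ (p := fun k l => form (π a k) l = form k (π (star a) l)) ?_ ?_ k l
    · unfold form
      exact isClosed_eq (by fun_prop) (by fun_prop)
    · intro f g
      change form (p a (ι f)) (ι g) = form (ι f) (p (star a) (ι g))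
      rw [hp, hp, hι, hι, mapKernel_psi]
  · ext ξ
    refine ext_form fun η => ?_
    rw [ContinuousLinearMap.comp_apply, ContinuousLinearMap.comp_apply, form_sharp_left, hB, hB, hπ,
      hform]
    simp
  · refine hd.mono ?_
    rintro _ ⟨f, rfl⟩
    induction f using Finsupp.induction_linear with
    | zero => simp
    | add f g hf hg => rw [map_add]; exact Submodule.add_mem _ hf hg
    -- The vector `π(x*) B ξ` is the class of `ξ_x`, so the span contains the dense range of `ι`.
    | single x ξ => exact Submodule.subset_span ⟨star x, ξ, by rw [hB, hπ]; simp⟩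

end Dilation

end KreinSpace

end

theorem mainTheorem11 {A : Type u} [Ring A] [StarRing A] [Algebra ℂ A] [StarModule ℂ A]
    {H : Type v} [NormedAddCommGroup H] [InnerProductSpace ℂ H] [CompleteSpace H] [KreinSpace H]
    (T : A →ₗ[ℂ] (H →L[ℂ] H)) (hT : KreinSpace.IsHermitianMap T) :
    (∃ L : A → A → H →L[ℂ] H,
      L ∈ KreinSpace.boundedPosDefKernels (KreinSpace.starAction (A := A)) ∧
      KreinSpace.KernelLE (-L) (KreinSpace.mapKernel T) ∧
      KreinSpace.KernelLE (KreinSpace.mapKernel T) L) ↔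
    KreinSpace.HasMinimalStinespringDilation.{u, v, max u v w} T := by

  refine ⟨fun ⟨L, hL, h₁, h₂⟩ =>
    KreinSpace.hasMinimalStinespringDilation_of_dominating_kernel.{u, v, w} hT hL h₁ h₂, ?_⟩
  rintro ⟨K, _, _, _, _, π, B, h⟩
  exact h.toIsStinespringDilation.exists_dominating_kernel
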